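/- A multicast network is a finite directed acyclic multigraph with a unique source node $s$ (the only node without incoming edges) and a set $T$ of receivers such that, with $\omega=|\mathrm{Out}(s)|$, the maximum number of edge-disjoint paths from $s$ to $t$ is $\omega$ for every $t\in T$. For a positive integer $L$, a vector linear code over $\mathrm{GF}(q)^L$ assigns to every pair $(d,e)$ of edges an $L\times L$ matrix $\mathbf K_{d,e}$ over $\mathrm{GF}(q)$, which is $\mathbf 0$ unless $d$ ends at the node where $e$ starts. Its global encoding kernels are the $\omega L\times L$ matrices $\mathbf F_e$ determined by $[\mathbf F_e]_{e\in \mathrm{Out}(s)}=\mathbf I$ and $\mathbf F_e=\sum_{d\in \mathrm{In}(v)}\mathbf F_d\mathbf K_{d,e}$ for every edge $e$ outgoing from a node $v\ne s$. The network is vector linearly solvable over $\mathrm{GF}(q)^L$ if some such code satisfies $\mathrm{rank}\,[\mathbf F_e]_{e\in \mathrm{In}(t)}=\omega L$ for every $t\in T$; it is scalar linearly solvable over $\mathrm{GF}(q)$ if this holds for $L=1$, that is, with scalar kernels $k_{d,e}\in\mathrm{GF}(q)$ and $\omega$-dimensional column vectors $\mathbf f_e$. Corollary. For every prime $p$ there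 are infinitely many positive integers $L$ (equivalently, infinitely many alphabet sizes $p^L$) for each of which there exists a multicast network that is vector linearly solvable over $\mathrm{GF}(p)^L$ but is not scalar linearly solvable over $\mathrm{GF}(q')$ for any prime power $q'\le p^L$. -/

import Mathlib

/-- A directed multigraph with node type `V` and edge type `E`: the edge `e` goes from the node
`tail e` to the node `head e`. Parallel edges are allowed. -/
structure DirMultigraph (V E : Type*) where
  tail : E → V
  head : E → V

namespace DirMultigraph

variable {V E : Type*} (G : DirMultigraph V E)

/-- `G.IsPath u l v`: the list of edges `l` leads from the node `u` to the node `v`, each edge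
starting where the previous one ends. (In an acyclic graph no node is visited twice.) -/
def IsPath : V → List E → V → Prop
  | u, [], v => u = v
  | u, e :: l, v => G.tail e = u ∧ IsPath (G.head e) l v

/-- No nonempty sequence of consecutive edges returns to its starting node. -/
def Acyclic : Prop :=
  ∀ (v : V) (l : List E), G.IsPath v l v → l = []

/-- `G.IsMaxFlow s t k`: the maximum number of pairwise edge-disjoint paths leading from `s` to `t`
is `k`. -/
def IsMaxFlow (s t : V) (k : ℕ) : Prop :=
  IsGreatest
    {n : ℕ | ∃ P : Fin n → List E, (∀ i, G.IsPath s (P i) t) ∧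
      ∀ i j, i ≠ j → List.Disjoint (P i) (P j)} k

section Edges

variable [DecidableEq V] [Fintype E]

/-- The set of incoming edges of a node. -/
def inEdges (v : V) : Finset E := Finset.univ.filter fun e => G.head e = v

/-- The set of outgoing edges of a node. -/
def outEdges (v : V) : Finset E := Finset.univ.filter fun e => G.tail e = v

end Edges

end DirMultigraph

/-- A (single-source) multicast network: a finite directed acyclic multigraph with a unique source
node, and a set of receivers each of which has maximum flow from the source equal to the number
of outgoing edges of the source. -/
structure MulticastNetwork (V E : Type*) [Fintype V] [DecidableEq V] [Fintype E]
    extends DirMultigraph V E where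
  acyclic : toDirMultigraph.Acyclic
  source : V
  inEdges_eq_empty_iff : ∀ v, toDirMultigraph.inEdges v = ∅ ↔ v = source
  receivers : Set V
  maxFlow : ∀ t ∈ receivers,
    toDirMultigraph.IsMaxFlow source t (toDirMultigraph.outEdges source).card

namespace MulticastNetwork

variable {V E : Type*} [Fintype V] [DecidableEq V] [Fintype E] [DecidableEq E]
  (N : MulticastNetwork V E)

/-- The source dimension: the number of outgoing edges of the source. -/
def sourceDim : ℕ := (N.outEdges N.source).card

/-- The index type of the source data units. -/
abbrev SourceEdge : Type _ := {e : E // e ∈ N.outEdges N.source}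

/-! ### Scalar linear network coding over a field `F` -/

/-- A scalar linear code: a local encoding kernel in `F` for every pair of edges, which vanishes
on pairs that are not adjacent. -/
structure ScalarCode (F : Type*) [Field F] where
  kernel : E → E → F
  kernel_eq_zero : ∀ d e, N.head d ≠ N.tail e → kernel d e = 0

/-- The columnwise juxtaposition of the vectors `f e`, for `e` in the set `A` of edges. -/
def scalarJuxt {F : Type*} (f : E → N.SourceEdge → F) (A : Finset E) :
    Matrix N.SourceEdge {e : E // e ∈ A} F :=
  Matrix.of fun i e => f e.1 i

/-- `f` is the family of global encoding kernels of the scalar code `C`. As the network is acyclic,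
there is exactly one such family. -/
def ScalarCode.IsGlobalKernel {N : MulticastNetwork V E} {F : Type*} [Field F]
    (C : N.ScalarCode F) (f : E → N.SourceEdge → F) : Prop :=
  N.scalarJuxt f (N.outEdges N.source) = 1 ∧
  ∀ e, N.tail e ≠ N.source → f e = ∑ d ∈ N.inEdges (N.tail e), C.kernel d e • f d

/-- A scalar code is a solution if, at every receiver, the juxtaposition of the global encoding
kernels of the incoming edges has full rank. -/
def ScalarCode.IsSolution {N : MulticastNetwork V E} {F : Type*} [Field F]
    (C : N.ScalarCode F) : Prop :=
  ∃ f, C.IsGlobalKernel f ∧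
    ∀ t ∈ N.receivers, (N.scalarJuxt f (N.inEdges t)).rank = N.sourceDim

/-- The network has a scalar linear solution over `F`. -/
def ScalarLinearlySolvable (F : Type*) [Field F] : Prop :=
  ∃ C : N.ScalarCode F, C.IsSolution

/-! ### Vector linear network coding of dimension `L` over a field `F` -/

/-- A vector linear code over `F ^ L`: a local encoding kernel, which is an `L × L` matrix over `F`,
for every pair of edges, which is the zero matrix on pairs that are not adjacent. -/
structure VectorCode (F : Type*) [Field F] (L : ℕ) where
  kernel : E → E → Matrix (Fin L) (Fin L) F
  kernel_eq_zero : ∀ d e, N.head d ≠ N.tail e → kernel d e = 0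

/-- The columnwise juxtaposition of the matrices `f e`, for `e` in the set `A` of edges. -/
def vectorJuxt {F : Type*} {L : ℕ} (f : E → Matrix (N.SourceEdge × Fin L) (Fin L) F)
    (A : Finset E) : Matrix (N.SourceEdge × Fin L) ({e : E // e ∈ A} × Fin L) F :=
  Matrix.of fun i c => f c.1.1 i c.2

/-- `f` is the family of global encoding kernels of the vector code `C`. As the network is acyclic,
there is exactly one such family. -/
def VectorCode.IsGlobalKernel {N : MulticastNetwork V E} {F : Type*} [Field F] {L : ℕ}
    (C : N.VectorCode F L) (f : E → Matrix (N.SourceEdge × Fin L) (Fin L) F) : Prop :=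
  N.vectorJuxt f (N.outEdges N.source) = 1 ∧
  ∀ e, N.tail e ≠ N.source → f e = ∑ d ∈ N.inEdges (N.tail e), f d * C.kernel d e

/-- A vector code is a solution if, at every receiver, the juxtaposition of the global encoding
kernels of the incoming edges has full rank. -/
def VectorCode.IsSolution {N : MulticastNetwork V E} {F : Type*} [Field F] {L : ℕ}
    (C : N.VectorCode F L) : Prop :=
  ∃ f, C.IsGlobalKernel f ∧
    ∀ t ∈ N.receivers, (N.vectorJuxt f (N.inEdges t)).rank = N.sourceDim * L

/-- The network has a vector linear solution over `F ^ L`. -/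
def VectorLinearlySolvable (F : Type*) [Field F] (L : ℕ) : Prop :=
  ∃ C : N.VectorCode F L, C.IsSolution

end MulticastNetwork

/-!
The network that separates vector from scalar solvability has source dimension `4`. A hub knows the
whole message and sends two data units to each of many relays, indexed by `I`; every pair of
distinct relays `i`, `j` has a receiver, which gets the two data units of `i`, the two data units
of `j`, and one further data unit directly from the hub.

A receiver can decode only if its two relays together hold a space of dimension at least `3`. Over a
field with `q` elements a relay holds a pair of vectors of length `4`, one of `q ^ 8` possible
pairs. With more than `q ^ 8` relays two of them hold the same pair, hence a common space of
dimension at most `2`, and the receiver fails (`relayNetwork_not_scalarLinearlySolvable`).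

For a vector code of dimension `L` over `ZMod p`, relay `i` holds a subspace of dimension `2 * L`
in a space of dimension `4 * L`, and it suffices that any two of these subspaces span at least
`3 * L` dimensions, since the direct edge can then carry a complement
(`relayNetwork_vectorLinearlySolvable`). Distinctness is thus replaced by a rank distance of `L`,
which leaves room for far more relays than `(p ^ L) ^ 8`. Explicitly, let `K` be the field with
`p ^ (2 * L)` elements and take the graphs in `K × K` of the linearized polynomials
`x ↦ ∑ k < 5, a k * x ^ (p ^ k)`. The graphs of two of these maps meet in a copy of the kernel of
their difference (`LinearMap.finrank_graph_sup_graph`), which consists of the roots of a nonzero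
polynomial of degree at most `p ^ 4` and so has dimension at most `4`
(`finrank_ker_linearizedMap_le`). For every `L ≥ 4` this gives `|K| ^ 5 = p ^ (10 * L)` admissible
relays, more than the `p ^ (8 * L)` that a scalar code over a field with at most `p ^ L` elements
can tolerate.
-/

/-! ### Paths, cuts and spanning families -/

/-- A directed multigraph in which every edge increases a height function on the nodes is
acyclic. -/
theorem DirMultigraph.acyclic_of_height {V E : Type*} (G : DirMultigraph V E) (h : V → ℕ)
    (hlt : ∀ e, h (G.tail e) < h (G.head e)) : G.Acyclic := by
  have key : ∀ (l : List E) (u v : V), G.IsPath u l v → h u + l.length ≤ h v := by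
    intro l
    induction l with
    | nil => rintro u v rfl; simp
    | cons e l ih =>
      rintro u v ⟨rfl, hp⟩
      have h1 := ih _ _ hp
      have h2 := hlt e
      simp only [List.length_cons]
      omega
  intro v l hl
  have := key l v v hl
  exact List.eq_nil_of_length_eq_zero (by omega)

theorem DirMultigraph.mem_outEdges {V E : Type*} [DecidableEq V] [Fintype E]
    {G : DirMultigraph V E} {v : V} {e : E} : e ∈ G.outEdges v ↔ G.tail e = v := by
  simp [DirMultigraph.outEdges]

theorem DirMultigraph.mem_inEdges {V E : Type*} [DecidableEq V] [Fintype E]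
    {G : DirMultigraph V E} {v : V} {e : E} : e ∈ G.inEdges v ↔ G.head e = v := by
  simp [DirMultigraph.inEdges]

/-- Edge-disjoint paths between distinct nodes start with distinct edges, so there are at most as
many of them as there are edges leaving the first node. -/
theorem DirMultigraph.card_paths_le {V E : Type*} [DecidableEq V] [Fintype E]
    (G : DirMultigraph V E) {s t : V} (hst : s ≠ t) {n : ℕ} (P : Fin n → List E)
    (hP : ∀ i, G.IsPath s (P i) t) (hd : ∀ i j, i ≠ j → List.Disjoint (P i) (P j)) :
    n ≤ (G.outEdges s).card := by
  have hfirst : ∀ i, ∃ e ∈ G.outEdges s, e ∈ P i := by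
    intro i
    have hi := hP i
    cases hc : P i with
    | nil => rw [hc] at hi; exact absurd hi hst
    | cons e l =>
      rw [hc] at hi
      exact ⟨e, DirMultigraph.mem_outEdges.2 hi.1, by simp⟩
  choose first hout hmem using hfirst
  have hinj : Function.Injective first := by
    intro i j hij
    by_contra hne
    exact hd i j hne (hmem i) (hij ▸ hmem j)
  simpa using Finset.card_le_card_of_injOn (s := Finset.univ) first (fun i _ => hout i)
    hinj.injOn

/-- The global encoding kernel of an edge that does not leave the source is a linear combination
of those of the edges entering its tail. -/
theorem MulticastNetwork.ScalarCode.IsGlobalKernel.mem_span {V E : Type*} [Fintype V]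
    [DecidableEq V] [Fintype E] [DecidableEq E] {N : MulticastNetwork V E} {F : Type*} [Field F]
    {C : N.ScalarCode F} {f : E → N.SourceEdge → F} (hf : C.IsGlobalKernel f) {e : E}
    (he : N.tail e ≠ N.source) {S : Submodule F (N.SourceEdge → F)}
    (hS : ∀ d ∈ N.inEdges (N.tail e), f d ∈ S) : f e ∈ S := by
  rw [hf.2 e he]
  exact S.sum_mem fun d hd => S.smul_mem _ (hS d hd)

/-- A finite-dimensional subspace is spanned by a family indexed by any type with at least as many
elements as its dimension. -/
theorem Submodule.exists_span_range_eq_of_finrank_le {F X ι : Type*} [Field F] [AddCommGroup X]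
    [Module F X] [Fintype ι] (W : Submodule F X) [FiniteDimensional F W]
    (h : Module.finrank F W ≤ Fintype.card ι) :
    ∃ b : ι → X, Submodule.span F (Set.range b) = W := by
  classical
  obtain ⟨g, hg⟩ : ∃ g : Fin (Module.finrank F W) → ι, Function.Injective g := by
    obtain ⟨g⟩ := Function.Embedding.nonempty_of_card_le
      (α := Fin (Module.finrank F W)) (β := ι) (by simpa using h)
    exact ⟨g, g.injective⟩
  let B := Module.finBasis F W
  refine ⟨Function.extend g (fun k => (B k : X)) 0, le_antisymm ?_ ?_⟩
  · rw [Submodule.span_le]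
    rintro _ ⟨i, rfl⟩
    by_cases hi : ∃ k, g k = i
    · obtain ⟨k, rfl⟩ := hi
      rw [hg.extend_apply]
      exact (B k).2
    · rw [Function.extend_apply' _ _ _ hi]
      exact W.zero_mem
  · have hW : Submodule.span F (Set.range fun k => (B k : X)) = W := by
      have := congrArg (Submodule.map W.subtype) B.span_eq
      rw [Submodule.map_span, Submodule.map_top, Submodule.range_subtype, ← Set.range_comp] at this
      exact this
    conv_lhs => rw [← hW]
    apply Submodule.span_mono
    rintro _ ⟨k, rfl⟩
    exact ⟨g k, hg.extend_apply _ _ _⟩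

/-! ### The relay network -/

/-- The nodes of the relay network over the index set `I`: the source, a hub that knows the whole
message, one relay for each index, and one sink for each pair of indices. -/
inductive RelayNode (I : Type) : Type
  | source
  | hub
  | relay (i : I)
  | sink (i j : I)
  deriving DecidableEq, Fintype

/-- The edges of the relay network: four edges `feed` from the source to the hub, two edges `fill`
from the hub to each relay, and, into the sink of `(i, j)`, two edges `left` from relay `i`, two
edges `right` from relay `j` and one edge `direct` from the hub. -/
inductive RelayEdge (I : Type) : Type
  | feed (k : Fin 4)
  | fill (i : I) (k : Fin 2)
  | left (i j : I) (k : Fin 2)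
  | right (i j : I) (k : Fin 2)
  | direct (i j : I)
  deriving DecidableEq, Fintype

/-- The underlying multigraph of the relay network. -/
def relayGraph (I : Type) : DirMultigraph (RelayNode I) (RelayEdge I) where
  tail
    | .feed _ => .source
    | .fill _ _ => .hub
    | .left i _ _ => .relay i
    | .right _ j _ => .relay j
    | .direct _ _ => .hub
  head
    | .feed _ => .hub
    | .fill i _ => .relay i
    | .left i j _ => .sink i j
    | .right i j _ => .sink i j
    | .direct i j => .sink i j

section RelayNetwork

variable {I : Type} [Fintype I] [DecidableEq I]

theorem mem_relayGraph_outEdges_source {e : RelayEdge I} :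
    e ∈ (relayGraph I).outEdges .source ↔ ∃ k, e = .feed k := by
  rw [DirMultigraph.mem_outEdges]
  cases e <;> simp [relayGraph]

theorem mem_relayGraph_inEdges_hub {e : RelayEdge I} :
    e ∈ (relayGraph I).inEdges .hub ↔ ∃ k, e = .feed k := by
  rw [DirMultigraph.mem_inEdges]
  cases e <;> simp [relayGraph]

theorem mem_relayGraph_inEdges_relay {e : RelayEdge I} {i : I} :
    e ∈ (relayGraph I).inEdges (.relay i) ↔ ∃ k, e = .fill i k := by
  rw [DirMultigraph.mem_inEdges]
  cases e <;> simp [relayGraph]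

theorem mem_relayGraph_inEdges_sink {e : RelayEdge I} {i j : I} :
    e ∈ (relayGraph I).inEdges (.sink i j) ↔
      (∃ k, e = .left i j k) ∨ (∃ k, e = .right i j k) ∨ e = .direct i j := by
  rw [DirMultigraph.mem_inEdges]
  cases e <;> simp [relayGraph]

variable (I) in
theorem card_relayGraph_outEdges_source :
    ((relayGraph I).outEdges .source).card = 4 := by
  have : (relayGraph I).outEdges .source = Finset.univ.image RelayEdge.feed := by
    ext e
    rw [mem_relayGraph_outEdges_source]
    simp [eq_comm]
  rw [this, Finset.card_image_of_injective _ fun a b h => by simpa using h]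
  simp

variable (I) in
/-- The relay network over `I`. The sinks of the pairs of distinct indices are the receivers; they
have maximum flow `4` already without the direct edges. -/
def relayNetwork : MulticastNetwork (RelayNode I) (RelayEdge I) where
  toDirMultigraph := relayGraph I
  acyclic := by
    refine (relayGraph I).acyclic_of_height
      (fun | .source => 0 | .hub => 1 | .relay _ => 2 | .sink _ _ => 3) fun e => ?_
    cases e <;> simp [relayGraph]
  source := .source
  inEdges_eq_empty_iff := by
    intro v
    constructor
    · intro h
      cases v with
      | source => rfl
      | hub => simpa [h] using (mem_relayGraph_inEdges_hub (I := I)).2 ⟨0, rfl⟩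
      | relay i => simpa [h] using (mem_relayGraph_inEdges_relay (i := i)).2 ⟨0, rfl⟩
      | sink i j =>
        simpa [h] using (mem_relayGraph_inEdges_sink (i := i) (j := j)).2 (.inr (.inr rfl))
    · rintro rfl
      ext e
      rw [DirMultigraph.mem_inEdges]
      cases e <;> simp [relayGraph]
  receivers := {t | ∃ i j, i ≠ j ∧ t = .sink i j}
  maxFlow := by
    rintro _ ⟨i, j, hij, rfl⟩
    constructor
    · rw [card_relayGraph_outEdges_source]
      refine ⟨![[.feed 0, .fill i 0, .left i j 0], [.feed 1, .fill i 1, .left i j 1],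
        [.feed 2, .fill j 0, .right i j 0], [.feed 3, .fill j 1, .right i j 1]], ?_, ?_⟩
      · intro k
        fin_cases k <;> simp [DirMultigraph.IsPath, relayGraph]
      · intro k l hkl
        fin_cases k <;> fin_cases l <;> simp_all [hij.symm]
    · rintro n ⟨P, hP, hd⟩
      exact (relayGraph I).card_paths_le (by simp) P hP hd

variable (I) in
theorem relayNetwork_sourceDim : (relayNetwork I).sourceDim = 4 :=
  card_relayGraph_outEdges_source I

/-! ### No scalar solution over a small field -/

/-- Two relays that receive the same pair of vectors supply their common sink with a space of
dimension at most two, which a single direct edge cannot complete to dimension four. -/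
theorem relayNetwork_not_scalarLinearlySolvable (F : Type) [Field F] [Fintype F]
    (hF : Fintype.card F ^ 8 < Fintype.card I) :
    ¬ (relayNetwork I).ScalarLinearlySolvable F := by
  classical
  rintro ⟨C, f, hf, hrank⟩
  have hcard : Fintype.card (relayNetwork I).SourceEdge = 4 := by
    rw [Fintype.card_coe]
    exact card_relayGraph_outEdges_source I
  obtain ⟨i, j, hij, hEq⟩ := Fintype.exists_ne_map_eq_of_card_lt
    (fun (i : I) (k : Fin 2) => f (.fill i k)) (by
      rw [Fintype.card_fun, Fintype.card_fun, hcard, Fintype.card_fin, ← pow_mul]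
      exact hF)
  have hEq' : ∀ k, f (.fill j k) = f (.fill i k) := fun k => (congrFun hEq k).symm
  let T : Finset ((relayNetwork I).SourceEdge → F) :=
    {f (.fill i 0), f (.fill i 1), f (.direct i j)}
  have hfill : ∀ k, f (.fill i k) ∈ Submodule.span F (T : Set _) := by
    intro k
    apply Submodule.subset_span
    fin_cases k <;> simp [T]
  have hcol : ∀ e ∈ (relayNetwork I).inEdges (.sink i j),
      f e ∈ Submodule.span F (T : Set _) := by
    intro e he
    rcases mem_relayGraph_inEdges_sink.1 he with ⟨k, rfl⟩ | ⟨k, rfl⟩ | rfl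
    · refine hf.mem_span (by simp [relayNetwork, relayGraph]) fun d hd => ?_
      obtain ⟨l, rfl⟩ := mem_relayGraph_inEdges_relay.1 hd
      exact hfill l
    · refine hf.mem_span (by simp [relayNetwork, relayGraph]) fun d hd => ?_
      obtain ⟨l, rfl⟩ := mem_relayGraph_inEdges_relay.1 hd
      exact hEq' l ▸ hfill l
    · exact Submodule.subset_span (by simp [T])
  have h4 := hrank (.sink i j) ⟨i, j, hij, rfl⟩
  rw [relayNetwork_sourceDim, Matrix.rank_eq_finrank_span_cols] at h4
  have hle : Submodule.span F (Set.range ((relayNetwork I).scalarJuxt f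
      ((relayNetwork I).inEdges (.sink i j))).col) ≤ Submodule.span F (T : Set _) := by
    rw [Submodule.span_le]
    rintro _ ⟨e, rfl⟩
    exact hcol e.1 e.2
  have h3 := (Submodule.finrank_mono hle).trans
    ((finrank_span_finset_le_card T).trans Finset.card_le_three)
  omega

/-! ### Vector solutions from families of subspaces -/

/-- The edge `feed k`, as a source data unit. -/
def relaySourceEdge (k : Fin 4) : (relayNetwork I).SourceEdge :=
  ⟨.feed k, mem_relayGraph_outEdges_source.2 ⟨k, rfl⟩⟩

/-- The global encoding kernels of the code in which relay `i` receives, and passes on unchanged,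
the columns `b i`, and the direct edge into the sink of `(i, j)` carries the columns `c i j`. -/
def relayGlobalKernel {F : Type*} [Field F] {L : ℕ}
    (b : I → Fin 2 × Fin L → ((relayNetwork I).SourceEdge × Fin L → F))
    (c : I → I → Fin L → ((relayNetwork I).SourceEdge × Fin L → F)) :
    RelayEdge I → Matrix ((relayNetwork I).SourceEdge × Fin L) (Fin L) F
  | .feed k => Matrix.of fun r y => if r = (relaySourceEdge k, y) then 1 else 0
  | .fill i k => Matrix.of fun r y => b i (k, y) r
  | .left i _ k => Matrix.of fun r y => b i (k, y) r
  | .right _ j k => Matrix.of fun r y => b j (k, y) r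
  | .direct i j => Matrix.of fun r y => c i j y r

/-- The local encoding kernels that produce `relayGlobalKernel b c`. -/
def relayLocalKernel {F : Type*} [Field F] {L : ℕ}
    (b : I → Fin 2 × Fin L → ((relayNetwork I).SourceEdge × Fin L → F))
    (c : I → I → Fin L → ((relayNetwork I).SourceEdge × Fin L → F)) :
    RelayEdge I → RelayEdge I → Matrix (Fin L) (Fin L) F
  | .feed l, .fill i k => Matrix.of fun x y => b i (k, y) (relaySourceEdge l, x)
  | .feed l, .direct i j => Matrix.of fun x y => c i j y (relaySourceEdge l, x)
  | .fill i k, .left i' _ k' => if i = i' ∧ k = k' then 1 else 0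
  | .fill i k, .right _ j k' => if i = j ∧ k = k' then 1 else 0
  | _, _ => 0

theorem relayLocalKernel_eq_zero {F : Type*} [Field F] {L : ℕ}
    (b : I → Fin 2 × Fin L → ((relayNetwork I).SourceEdge × Fin L → F))
    (c : I → I → Fin L → ((relayNetwork I).SourceEdge × Fin L → F)) (d e : RelayEdge I)
    (h : (relayNetwork I).head d ≠ (relayNetwork I).tail e) : relayLocalKernel b c d e = 0 := by
  cases d <;> cases e <;> try rfl
  · exact absurd rfl h
  · exact absurd rfl h
  · exact if_neg fun hik => h (congrArg RelayNode.relay hik.1)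
  · exact if_neg fun hik => h (congrArg RelayNode.relay hik.1)

/-- A choice of a subspace of dimension at most `2 * L` for every relay, such that any two of them
span a space of codimension at most `L`, gives a vector linear solution: the direct edge carries a
complement. -/
theorem relayNetwork_vectorLinearlySolvable {F : Type*} [Field F] {L : ℕ}
    (W : I → Submodule F ((relayNetwork I).SourceEdge × Fin L → F))
    (hW : ∀ i, Module.finrank F (W i) ≤ 2 * L)
    (hW' : ∀ i j, i ≠ j → 3 * L ≤ Module.finrank F ↥(W i ⊔ W j)) :
    (relayNetwork I).VectorLinearlySolvable F L := by
  classical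
  have hcard : Fintype.card (relayNetwork I).SourceEdge = 4 := by
    rw [Fintype.card_coe]
    exact card_relayGraph_outEdges_source I
  have hb : ∀ i, ∃ b : Fin 2 × Fin L → ((relayNetwork I).SourceEdge × Fin L → F),
      Submodule.span F (Set.range b) = W i := fun i =>
    (W i).exists_span_range_eq_of_finrank_le (by simpa using hW i)
  choose b hb using hb
  have hc : ∀ i j, ∃ c : Fin L → ((relayNetwork I).SourceEdge × Fin L → F),
      i ≠ j → W i ⊔ W j ⊔ Submodule.span F (Set.range c) = ⊤ := by
    intro i j
    by_cases hij : i = j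
    · exact ⟨0, fun h => absurd hij h⟩
    obtain ⟨Z, hZ⟩ := (W i ⊔ W j).exists_isCompl
    have hdim := Submodule.finrank_add_eq_of_isCompl hZ
    rw [Module.finrank_fintype_fun_eq_card, Fintype.card_prod, hcard, Fintype.card_fin] at hdim
    have := hW' i j hij
    obtain ⟨c, hc⟩ := Z.exists_span_range_eq_of_finrank_le (ι := Fin L) (by simp; omega)
    exact ⟨c, fun _ => by rw [hc]; exact hZ.sup_eq_top⟩
  choose c hc using hc
  let f := relayGlobalKernel b c
  let σ := relaySourceEdge (I := I)
  have hhub : (relayGraph I).inEdges .hub = Finset.univ.image RelayEdge.feed := by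
    ext e
    rw [mem_relayGraph_inEdges_hub]
    simp [eq_comm]
  have hrelay : ∀ i, (relayGraph I).inEdges (.relay i) = Finset.univ.image (RelayEdge.fill i) := by
    intro i
    ext e
    rw [mem_relayGraph_inEdges_relay]
    simp [eq_comm]
  have hσ : ∀ e, ∃ k, σ k = e := by
    rintro ⟨e, he⟩
    obtain ⟨k, rfl⟩ := mem_relayGraph_outEdges_source.1 he
    exact ⟨k, rfl⟩
  have hσi : ∀ k l, σ k = σ l ↔ k = l := by
    intro k l
    rw [Subtype.ext_iff]
    exact ⟨fun h => RelayEdge.feed.inj h, congrArg RelayEdge.feed⟩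
  -- The hub recovers any block of columns `M` from the identity blocks on the edges `feed`.
  have hfeed : ∀ M : Matrix ((relayNetwork I).SourceEdge × Fin L) (Fin L) F,
      M = ∑ l, f (.feed l) * Matrix.of fun x y => M (σ l, x) y := by
    intro M
    ext ⟨e, x⟩ y
    obtain ⟨k, rfl⟩ := hσ e
    simp [Matrix.sum_apply, Matrix.mul_apply, f, relayGlobalKernel, σ, hσi, ite_and]
  refine ⟨⟨relayLocalKernel b c, relayLocalKernel_eq_zero b c⟩, f, ⟨?_, ?_⟩, ?_⟩
  · ext ⟨e, x⟩ ⟨e', y⟩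
    obtain ⟨k, rfl⟩ := hσ e
    obtain ⟨l, rfl⟩ := hσ e'
    simp [MulticastNetwork.vectorJuxt, f, relayGlobalKernel, Matrix.one_apply, σ, relaySourceEdge]
  · intro e he
    cases e with
    | feed k => exact absurd rfl he
    | fill i k =>
      change _ = ∑ d ∈ (relayGraph I).inEdges .hub, _
      rw [hhub, Finset.sum_image fun _ _ _ _ h => by simpa using h]
      exact hfeed _
    | direct i j =>
      change _ = ∑ d ∈ (relayGraph I).inEdges .hub, _
      rw [hhub, Finset.sum_image fun _ _ _ _ h => by simpa using h]
      exact hfeed _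
    | left i j k =>
      change _ = ∑ d ∈ (relayGraph I).inEdges (.relay i), _
      rw [hrelay, Finset.sum_image fun _ _ _ _ h => by simpa using h]
      fin_cases k <;> simp [relayLocalKernel, f, relayGlobalKernel]
    | right i j k =>
      change _ = ∑ d ∈ (relayGraph I).inEdges (.relay j), _
      rw [hrelay, Finset.sum_image fun _ _ _ _ h => by simpa using h]
      fin_cases k <;> simp [relayLocalKernel, f, relayGlobalKernel]
  · rintro _ ⟨i, j, hij, rfl⟩
    rw [Matrix.rank_eq_finrank_span_cols]
    set S := Submodule.span F (Set.range ((relayNetwork I).vectorJuxt f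
      ((relayNetwork I).inEdges (.sink i j))).col)
    have hmem : ∀ e ∈ (relayGraph I).inEdges (.sink i j), ∀ y, (fun r => f e r y) ∈ S :=
      fun e he y => Submodule.subset_span ⟨(⟨e, he⟩, y), rfl⟩
    have htop : S = ⊤ := by
      rw [eq_top_iff, ← hc i j hij, ← hb i, ← hb j, sup_le_iff, sup_le_iff]
      simp only [Submodule.span_le]
      refine ⟨⟨?_, ?_⟩, ?_⟩
      · rintro _ ⟨⟨k, y⟩, rfl⟩
        exact hmem (.left i j k) (mem_relayGraph_inEdges_sink.2 (.inl ⟨k, rfl⟩)) y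
      · rintro _ ⟨⟨k, y⟩, rfl⟩
        exact hmem (.right i j k) (mem_relayGraph_inEdges_sink.2 (.inr (.inl ⟨k, rfl⟩))) y
      · rintro _ ⟨y, rfl⟩
        exact hmem (.direct i j) (mem_relayGraph_inEdges_sink.2 (.inr (.inr rfl))) y
    rw [htop, finrank_top, Module.finrank_fintype_fun_eq_card, Fintype.card_prod, hcard,
      Fintype.card_fin, relayNetwork_sourceDim]

end RelayNetwork

/-! ### Linearized polynomials and their graphs -/

section LinearizedPolynomial

variable {p : ℕ} [Fact p.Prime] {K : Type*} [Field K] [Algebra (ZMod p) K]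

/-- The `ZMod p`-linear map `x ↦ ∑ k < n, a k * x ^ (p ^ k)` of a field of characteristic `p`. -/
noncomputable def linearizedMap {n : ℕ} (a : Fin n → K) : K →ₗ[ZMod p] K :=
  ∑ k, LinearMap.mulLeft (ZMod p) (a k) ∘ₗ
    ((FiniteField.frobeniusAlgHom (ZMod p) K) ^ (k : ℕ)).toLinearMap

theorem linearizedMap_apply {n : ℕ} (a : Fin n → K) (x : K) :
    linearizedMap (p := p) a x = ∑ k, a k * x ^ p ^ (k : ℕ) := by
  simp [linearizedMap, AlgHom.coe_pow, FiniteField.coe_frobeniusAlgHom, pow_iterate]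

/-- A nonzero linearized polynomial of degree at most `p ^ m` has at most `p ^ m` roots, so its
kernel has dimension at most `m`. -/
theorem finrank_ker_linearizedMap_le [Finite K] {m : ℕ} {a : Fin (m + 1) → K} (ha : a ≠ 0) :
    Module.finrank (ZMod p) (LinearMap.ker (linearizedMap (p := p) a)) ≤ m := by
  classical
  have hp : p.Prime := Fact.out
  have := Fintype.ofFinite K
  let P : Polynomial K := ∑ k, Polynomial.C (a k) * Polynomial.X ^ p ^ (k : ℕ)
  have hcoeff : ∀ k : Fin (m + 1), P.coeff (p ^ (k : ℕ)) = a k := by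
    intro k
    simp only [P, Polynomial.finsetSum_coeff, Polynomial.coeff_C_mul_X_pow,
      Nat.pow_right_inj hp.one_lt, Fin.val_inj]
    simp
  have hP : P ≠ 0 := by
    obtain ⟨k, hk⟩ := Function.ne_iff.1 ha
    intro h
    apply hk
    rw [← hcoeff k, h]
    simp
  have hdeg : P.natDegree ≤ p ^ m := by
    refine Polynomial.natDegree_sum_le_of_forall_le _ _ fun k _ => ?_
    exact (Polynomial.natDegree_C_mul_X_pow_le _ _).trans
      (Nat.pow_le_pow_right hp.pos (Nat.lt_succ_iff.1 k.2))
  have hroot : ∀ x : LinearMap.ker (linearizedMap (p := p) a), (x : K) ∈ P.roots.toFinset := by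
    rintro ⟨x, hx⟩
    rw [Multiset.mem_toFinset, Polynomial.mem_roots hP, Polynomial.IsRoot]
    simpa [P, Polynomial.eval_finsetSum, linearizedMap_apply] using hx
  have hcard : Fintype.card (LinearMap.ker (linearizedMap (p := p) a)) ≤ p ^ m := by
    calc _ ≤ P.roots.toFinset.card := by
          simpa using Finset.card_le_card_of_injOn (s := Finset.univ)
            (Subtype.val : LinearMap.ker (linearizedMap (p := p) a) → K)
            (fun x _ => hroot x) Subtype.val_injective.injOn
      _ ≤ P.natDegree := (Multiset.toFinset_card_le _).trans P.card_roots'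
      _ ≤ p ^ m := hdeg
  rw [Module.card_eq_pow_finrank (K := ZMod p), ZMod.card] at hcard
  exact (Nat.pow_le_pow_iff_right hp.one_lt).1 hcard

theorem linearizedMap_sub {n : ℕ} (a b : Fin n → K) :
    linearizedMap (p := p) (a - b) = linearizedMap a - linearizedMap b := by
  ext x
  simp [linearizedMap_apply, sub_mul]

end LinearizedPolynomial

/-- The graphs of two linear maps `g` and `h` meet in a copy of the kernel of `g - h`. -/
theorem LinearMap.finrank_graph_sup_graph {F X Y : Type*} [Field F] [AddCommGroup X] [Module F X]
    [AddCommGroup Y] [Module F Y] [FiniteDimensional F X] [FiniteDimensional F Y]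
    (g h : X →ₗ[F] Y) :
    Module.finrank F ↥(g.graph ⊔ h.graph) + Module.finrank F (LinearMap.ker (g - h)) =
      Module.finrank F X + Module.finrank F X := by
  have hgraph : ∀ k : X →ₗ[F] Y, Module.finrank F k.graph = Module.finrank F X := by
    intro k
    rw [LinearMap.graph_eq_range_prod]
    exact LinearMap.finrank_range_of_inj fun x y hxy => (Prod.ext_iff.1 hxy).1
  have hinf : g.graph ⊓ h.graph =
      (LinearMap.ker (g - h)).map (LinearMap.prod LinearMap.id g) := by
    ext ⟨x, y⟩
    simp only [Submodule.mem_inf, LinearMap.mem_graph_iff, Submodule.mem_map, LinearMap.mem_ker,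
      LinearMap.sub_apply, sub_eq_zero, LinearMap.prod_apply, Function.prod_apply,
      LinearMap.id_apply, Prod.mk.injEq]
    constructor
    · rintro ⟨h1, h2⟩
      exact ⟨x, h1.symm.trans h2, rfl, h1.symm⟩
    · rintro ⟨_, h1, rfl, rfl⟩
      exact ⟨rfl, h1⟩
  have hker : Module.finrank F ↥(g.graph ⊓ h.graph) =
      Module.finrank F (LinearMap.ker (g - h)) := by
    rw [hinf]
    exact (Submodule.equivMapOfInjective _
      (fun x y hxy => (Prod.ext_iff.1 hxy).1) _).finrank_eq.symm
  rw [← hker, Submodule.finrank_sup_add_finrank_inf_eq, hgraph, hgraph]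

/-! ### Counting relays against alphabet sizes -/

theorem mainTheorem2 (p : ℕ) [Fact p.Prime] :
    {L : ℕ | 1 ≤ L ∧
      ∃ (V E : Type) (_ : Fintype V) (_ : DecidableEq V) (_ : Fintype E) (_ : DecidableEq E)
        (N : MulticastNetwork V E),
        N.VectorLinearlySolvable (ZMod p) L ∧
        ∀ (F : Type) [Field F] [Fintype F], Fintype.card F ≤ p ^ L →
          ¬ N.ScalarLinearlySolvable F}.Infinite := by
  refine (Set.Ici_infinite 4).mono fun L (hL : 4 ≤ L) => ?_
  classical
  have hp : p.Prime := Fact.out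
  let K := GaloisField p (2 * L)
  have hK : Module.finrank (ZMod p) K = 2 * L := GaloisField.finrank p (by omega)
  have : Fintype K := Fintype.ofFinite K
  -- Five coefficients are the fewest for which `|K| ^ 5` exceeds `(p ^ L) ^ 8`; the degree is then
  -- at most `p ^ 4`, which is where `4 ≤ L` is needed.
  let I := Fin 5 → K
  have hI : Fintype.card I = p ^ (10 * L) := by
    rw [Fintype.card_fun, Fintype.card_fin, Module.card_eq_pow_finrank (K := ZMod p), hK,
      ZMod.card, ← pow_mul]
    congr 1
    ring
  refine ⟨by omega, RelayNode I, RelayEdge I, inferInstance, inferInstance, inferInstance,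
    inferInstance, relayNetwork I, ?_, ?_⟩
  · have hdim : Module.finrank (ZMod p) (K × K) =
        Module.finrank (ZMod p) ((relayNetwork I).SourceEdge × Fin L → ZMod p) := by
      rw [Module.finrank_prod, hK, Module.finrank_fintype_fun_eq_card, Fintype.card_prod,
        Fintype.card_coe, Fintype.card_fin]
      change _ = (relayNetwork I).sourceDim * L
      rw [relayNetwork_sourceDim]
      ring
    let ψ := LinearEquiv.ofFinrankEq (K × K) _ hdim
    refine relayNetwork_vectorLinearlySolvable
      (fun a => (linearizedMap (p := p) a).graph.map ψ.toLinearMap) (fun a => ?_)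
      fun a b hab => ?_
    · -- The sum of a graph with itself gives its dimension.
      have hzero := LinearMap.finrank_graph_sup_graph (linearizedMap (p := p) a) (linearizedMap a)
      rw [sup_idem, sub_self, LinearMap.ker_zero, finrank_top] at hzero
      rw [LinearEquiv.finrank_map_eq]
      omega
    · have hsup := LinearMap.finrank_graph_sup_graph (linearizedMap (p := p) a) (linearizedMap b)
      rw [← linearizedMap_sub] at hsup
      have hker := finrank_ker_linearizedMap_le (p := p) (sub_ne_zero.2 hab)
      rw [← Submodule.map_sup, LinearEquiv.finrank_map_eq]
      omega
  · intro F _ _ hF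
    refine relayNetwork_not_scalarLinearlySolvable F ?_
    calc Fintype.card F ^ 8 ≤ (p ^ L) ^ 8 := Nat.pow_le_pow_left hF 8
      _ = p ^ (8 * L) := by rw [← pow_mul, mul_comm]
      _ < p ^ (10 * L) := Nat.pow_lt_pow_right hp.one_lt (by omega)
      _ = Fintype.card I := hI.symm
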